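/- Let $a\in(1,\infty)$ and $\mathbb{T}^2=\{(x,y,z)\in\mathbb{R}^3:(x^2+y^2-a^2)^2+z^2-1=0\}$. For a polynomial vector field $\chi=(P,Q,R)$ on $\mathbb{R}^3$, with $P,Q,R\in\mathbb{R}[x,y,z]$, and $g\in\mathbb{R}[x,y,z]$ write $\chi g=P\,\partial_xg+Q\,\partial_yg+R\,\partial_zg$; the hypersurface $\{g=0\}$ is called invariant for $\chi$ if $\chi g=Kg$ for some $K\in\mathbb{R}[x,y,z]$. A plane $z-k=0$ ($k\in\mathbb{R}$) that is invariant for $\chi$ is called an invariant parallel plane of $\chi$; its multiplicity is the largest $m$ such that $(z-k)^m$ divides the extactic polynomial $\det\begin{pmatrix}1&z\\ \chi(1)&\chi(z)\end{pmatrix}$, and is $\infty$ if this polynomial is zero. The set $\mathbb{T}^2\cap\{z=k\}$ is called the parallel on $z-k=0$. A periodic orbit of $\chi$ is the image of a nonconstant periodic solution $\mathbb{R}\to\mathbb{R}^3$ of $\dot x=P,\ \dot y=Q,\ \dot z=R$. Suppose that $\deg P,\deg Q,\deg R\le 3$, that $\chi$ is a vector field on $\mathbb{T}^2$ (i.e.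 $\{(x^2+y^2-a^2)^2+z^2-1=0\}$ is invariant for $\chi$), and that $\chi$ has at least two invariant parallel planes, counted with multiplicity. Then there are $f\in\mathbb{R}[x,y,z]$ with $\deg f\le 2$ and $p,q\in\mathbb{R}$ such that $$P=\tfrac12xz(px+qy)+fy-\tfrac{a^2p}{2}z,\qquad Q=\tfrac12yz(px+qy)-fx-\tfrac{a^2q}{2}z,\qquad R=(px+qy)(z^2-1).\tag{1.4}$$ Moreover, $z-1=0$ and $z+1=0$ are invariant parallel planes of $\chi$, and if $\chi$ has only finitely many invariant parallel planes, then they are the only ones. Also, for all $f,p,q$ as in (1.4), the parallel on $z-1=0$ is a periodic orbit of $\chi$ if and only if $f(x,y,1)-\frac12(py-qx)=0$ has no solution on the circle $x^2+y^2=a^2$, and the parallel on $z+1=0$ is a periodic orbit of $\chi$ if and only if $f(x,y,-1)+\frac12(py-qx)=0$ has no solution on the circle $x^2+y^2=a^2$. -/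

import Mathlib

open MvPolynomial

namespace TorusField

noncomputable section

/-- The polynomial ring `ℝ[x, y, z]`; the variables `x, y, z` are `X 0, X 1, X 2`. -/
abbrev Poly : Type := MvPolynomial (Fin 3) ℝ

/-- A polynomial vector field `χ = (P, Q, R)` on `ℝ³`, with `P = χ 0`, `Q = χ 1`, `R = χ 2`. -/
abbrev VField : Type := Fin 3 → Poly

/-- `χ g = P ∂g/∂x + Q ∂g/∂y + R ∂g/∂z`. -/
def act (χ : VField) (g : Poly) : Poly := ∑ i, χ i * pderiv i g

/-- The degree `max {deg P, deg Q, deg R}` of a vector field. -/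
def degree (χ : VField) : ℕ :=
  max (χ 0).totalDegree (max (χ 1).totalDegree (χ 2).totalDegree)

/-- The algebraic hypersurface `g = 0` is invariant for `χ`, with some polynomial cofactor `K`. -/
def IsInvariant (χ : VField) (g : Poly) : Prop := ∃ K : Poly, act χ g = K * g

/-- The polynomial `(x² + y² - a²)² + z² - 1` that defines the torus. -/
def torusPoly (a : ℝ) : Poly :=
  (X 0 ^ 2 + X 1 ^ 2 - C (a ^ 2)) ^ 2 + X 2 ^ 2 - 1

/-- The torus `𝕋²` as a subset of `ℝ³`. -/
def torus (a : ℝ) : Set (Fin 3 → ℝ) := {v | eval v (torusPoly a) = 0}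

/-- The polynomial `z - k` of a parallel plane. -/
def planePoly (k : ℝ) : Poly := X 2 - C k

/-- The plane `z - k = 0` is an invariant parallel plane of `χ`. -/
def IsInvariantParallelPlane (χ : VField) (k : ℝ) : Prop := IsInvariant χ (planePoly k)

/-- The extactic polynomial of `χ` associated with the span of `v`: the determinant whose
`i`-th row is `χⁱ(v₁), …, χⁱ(v_ℓ)`, `0 ≤ i < ℓ`. -/
def extactic (χ : VField) {l : ℕ} (v : Fin l → Poly) : Poly :=
  (Matrix.of fun i j : Fin l => (act χ)^[(i : ℕ)] (v j)).det

/-- The multiplicity of the plane `z - k = 0`: the exponent of `z - k` in the extactic polynomial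
associated with `⟨1, z⟩`, and `⊤` if that polynomial vanishes. -/
def parallelMultiplicity (χ : VField) (k : ℝ) : ℕ∞ :=
  emultiplicity (planePoly k) (extactic χ ![1, X 2])

/-- `χ` has (at least) two invariant parallel planes, counted with multiplicity. -/
def HasTwoInvariantParallelPlanes (χ : VField) : Prop :=
  ∃ k₁ k₂ : ℝ, IsInvariantParallelPlane χ k₁ ∧ IsInvariantParallelPlane χ k₂ ∧
    (k₁ = k₂ → 2 ≤ parallelMultiplicity χ k₁)

/-- The parallel on the plane `z - k = 0`. -/
def parallel (a k : ℝ) : Set (Fin 3 → ℝ) := torus a ∩ {v | v 2 = k}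

/-- `γ` is a (globally defined) solution of `(x', y', z') = (P, Q, R)`. -/
def IsSolution (χ : VField) (γ : ℝ → Fin 3 → ℝ) : Prop :=
  ∀ t : ℝ, HasDerivAt γ (fun i => eval (γ t) (χ i)) t

/-- `S` is a periodic orbit of `χ`: the trace of a nonconstant periodic solution. -/
def IsPeriodicOrbit (χ : VField) (S : Set (Fin 3 → ℝ)) : Prop :=
  ∃ γ : ℝ → Fin 3 → ℝ, IsSolution χ γ ∧ (∃ T : ℝ, 0 < T ∧ Function.Periodic γ T) ∧
    (∃ s t : ℝ, γ s ≠ γ t) ∧ Set.range γ = S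

/-- The explicit form of the components, with parameters `p, q ∈ ℝ` and a polynomial `f` of
degree at most two. -/
def HasForm (a : ℝ) (χ : VField) (f : Poly) (p q : ℝ) : Prop :=
  f.totalDegree ≤ 2 ∧
  χ 0 = C (1 / 2) * X 0 * X 2 * (C p * X 0 + C q * X 1) + f * X 1 - C (a ^ 2 * p / 2) * X 2 ∧
  χ 1 = C (1 / 2) * X 1 * X 2 * (C p * X 0 + C q * X 1) - f * X 0 - C (a ^ 2 * q / 2) * X 2 ∧
  χ 2 = (C p * X 0 + C q * X 1) * (X 2 ^ 2 - 1)

end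

end TorusField

/-!
The idea is to compare the field with the torus equation on the planes `z = ±1`, where the torus
degenerates. Write `χ = (P, Q, R)`, `u = x² + y² - a²` and `T = u² + z² - 1`, so that invariance of
the torus reads `4 u (xP + yQ) + 2 z R = K T`.

As `χ(z - k) = R`, a plane `z = k` is invariant exactly when `z - k` divides `R`, and the extactic
polynomial of `⟨1, z⟩` is `R` itself. Two invariant parallel planes therefore give
`R = (z - k₁)(z - k₂) L` with `deg L ≤ 1`. Restricted to `z = ±1` the invariance identity says that
`u` divides `R`, whose restriction has degree at most one; hence `R` vanishes there and is a multiple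
of `z² - 1` (`sq_sub_one_dvd`). With `R = (z² - 1) L` for a new linear `L`, coprimality of `u` and
`z² - 1` turns the identity into `4 (xP + yQ) = 2 z L u + V T`. Degrees make `V` constant, and the
values on the axis `x = y = 0` give `V = 0` and `L = p x + q y` (`exists_polar_eq`). The resulting
formula for `xP + yQ` fixes `P` and `Q` up to a multiple `f` of the rotation field `(y, -x)`
(`exists_hasForm`).

On the parallel `z = ε`, `ε = ±1`, the field in explicit form is `G · (y, -x, 0)` with
`G = f - ε (p y - q x) / 2`. If `G` has no zero there, the angle satisfies a scalar equation with
nonvanishing periodic right-hand side, whose solution is obtained by inverting an integral and runs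
around the circle periodically. If `G` has a zero, that point is an equilibrium, and uniqueness for
ordinary differential equations keeps nonconstant solutions away from it
(`isPeriodicOrbit_parallel_iff`).
-/

open MvPolynomial

namespace TorusField

/-! ### Invariant planes and the torus -/

theorem act_planePoly (χ : VField) (k : ℝ) : act χ (planePoly k) = χ 2 := by
  simp [act, planePoly, pderiv_X, Pi.single_apply]

theorem act_torusPoly (χ : VField) (a : ℝ) :
    act χ (torusPoly a) =
      4 * (X 0 ^ 2 + X 1 ^ 2 - C (a ^ 2)) * (X 0 * χ 0 + X 1 * χ 1) + 2 * X 2 * χ 2 := by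
  simp [act, torusPoly, Fin.sum_univ_three, pderiv_X, Pi.single_apply, -map_pow]
  ring

/-- Since `χ(1) = 0` and `χ(z) = R`, the extactic polynomial of `⟨1, z⟩` is the third component. -/
theorem extactic_one_X (χ : VField) : extactic χ ![1, X 2] = χ 2 := by
  simp [extactic, Matrix.det_fin_two, act, pderiv_X, Pi.single_apply]

theorem isInvariantParallelPlane_iff (χ : VField) (k : ℝ) :
    IsInvariantParallelPlane χ k ↔ X 2 - C k ∣ χ 2 := by
  unfold IsInvariantParallelPlane IsInvariant
  rw [act_planePoly]
  exact ⟨fun ⟨K, h⟩ => ⟨K, by rw [h, planePoly, mul_comm]⟩,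
    fun ⟨K, h⟩ => ⟨K, by rw [h, planePoly, mul_comm]⟩⟩

/-! ### Restriction to a horizontal plane -/

/-- Restriction to the plane `z = k`, as the substitution `z ↦ k`. The result stays in `ℝ[x, y, z]`,
so that restrictions and unrestricted polynomials live in the same domain. -/
noncomputable def restrictPlane (k : ℝ) : Poly →ₐ[ℝ] Poly := aeval ![X 0, X 1, C k]

@[simp] theorem restrictPlane_X0 (k : ℝ) : restrictPlane k (X 0) = X 0 := by simp [restrictPlane]

@[simp] theorem restrictPlane_X1 (k : ℝ) : restrictPlane k (X 1) = X 1 := by simp [restrictPlane]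

@[simp] theorem restrictPlane_X2 (k : ℝ) : restrictPlane k (X 2) = C k := by simp [restrictPlane]

@[simp] theorem restrictPlane_C (k r : ℝ) : restrictPlane k (C r) = C r := by
  simp [restrictPlane, algebraMap_eq]

theorem X2_sub_C_dvd_sub_restrictPlane (k : ℝ) (F : Poly) :
    X 2 - C k ∣ F - restrictPlane k F := by
  induction F using MvPolynomial.induction_on with
  | C r => simp
  | add F G hF hG =>
    rw [map_add, add_sub_add_comm]
    exact dvd_add hF hG
  | mul_X F i hF =>
    have hi : (X 2 - C k : Poly) ∣ X i - restrictPlane k (X i) := by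
      fin_cases i <;> simp
    rw [map_mul, show F * X i - restrictPlane k F * restrictPlane k (X i) =
      F * (X i - restrictPlane k (X i)) + (F - restrictPlane k F) * restrictPlane k (X i) by ring]
    exact dvd_add (hi.mul_left _) (hF.mul_right _)

theorem X2_sub_C_dvd_iff (k : ℝ) (F : Poly) : X 2 - C k ∣ F ↔ restrictPlane k F = 0 := by
  constructor
  · rintro ⟨G, rfl⟩
    simp
  · intro h
    simpa [h] using X2_sub_C_dvd_sub_restrictPlane k F

theorem sq_sub_one_dvd_iff (F : Poly) :
    (X 2 ^ 2 - 1 : Poly) ∣ F ↔ restrictPlane 1 F = 0 ∧ restrictPlane (-1) F = 0 := by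
  constructor
  · rintro ⟨G, rfl⟩
    simp
  · rintro ⟨h1, h2⟩
    obtain ⟨G, rfl⟩ := (X2_sub_C_dvd_iff 1 F).2 h1
    have : restrictPlane (-1) G = 0 := by
      rw [map_mul] at h2
      refine (mul_eq_zero.1 h2).resolve_left ?_
      rw [map_sub, restrictPlane_X2, restrictPlane_C, ← C_sub]
      exact fun h0 => by norm_num [C_eq_zero] at h0
    obtain ⟨H, rfl⟩ := (X2_sub_C_dvd_iff (-1) G).2 this
    exact ⟨H, by simp only [map_neg, map_one]; ring⟩

/-! ### Degrees -/

/-- Restricting a polynomial to a parametrized line does not raise its degree. This bounds total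
degrees from below. -/
theorem natDegree_aeval_le_totalDegree (F : Poly) (g : Fin 3 → Polynomial ℝ)
    (hg : ∀ i, (g i).natDegree ≤ 1) : (aeval g F).natDegree ≤ F.totalDegree := by
  simpa using aeval_natDegree_le F le_rfl g hg

theorem eq_linear_of_totalDegree_le_one (L : Poly) (h : L.totalDegree ≤ 1) :
    ∃ l p q r : ℝ, L = C l + C p * X 0 + C q * X 1 + C r * X 2 := by
  have hs : L = ∑ i ∈ Finset.range 2, homogeneousComponent i L := by
    conv_lhs => rw [← sum_homogeneousComponent L]
    refine Finset.sum_subset (by intro i; simp; omega) ?_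
    intro i _ hi
    exact homogeneousComponent_eq_zero _ _ (by simpa using hi)
  have h1 : homogeneousComponent 1 L ∈ homogeneousSubmodule (Fin 3) ℝ 1 :=
    homogeneousComponent_mem 1 L
  rw [homogeneousSubmodule_one_eq_span_X, Submodule.mem_span_range_iff_exists_fun] at h1
  obtain ⟨c, hc⟩ := h1
  refine ⟨coeff 0 L, c 0, c 1, c 2, ?_⟩
  rw [Finset.sum_range_succ, Finset.sum_range_one, ← hc, homogeneousComponent_zero] at hs
  simpa [Fin.sum_univ_three, smul_eq_C_mul, add_assoc] using hs

theorem le_totalDegree_torusPoly (a : ℝ) : 4 ≤ (torusPoly a).totalDegree := by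
  refine le_trans (le_of_eq ?_) (natDegree_aeval_le_totalDegree _ ![Polynomial.X, 0, 0] ?_)
  · have : aeval ![Polynomial.X, 0, 0] (torusPoly a) =
        ((Polynomial.X ^ 2 - Polynomial.C (a ^ 2)) ^ 2 - 1 : Polynomial ℝ) := by
      simp [torusPoly]
    rw [this]
    symm
    compute_degree!
  · intro i
    fin_cases i <;> simp

theorem le_totalDegree_cylinder (b : ℝ) :
    2 ≤ (X 0 ^ 2 + X 1 ^ 2 - C b : Poly).totalDegree := by
  refine le_trans (le_of_eq ?_) (natDegree_aeval_le_totalDegree _ ![Polynomial.X, 0, 0] ?_)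
  · have : aeval ![Polynomial.X, 0, 0] (X 0 ^ 2 + X 1 ^ 2 - C b : Poly) =
        (Polynomial.X ^ 2 - Polynomial.C b : Polynomial ℝ) := by
      simp
    rw [this]
    symm
    compute_degree!
  · intro i
    fin_cases i <;> simp

theorem totalDegree_planePoly (k : ℝ) : (X 2 - C k : Poly).totalDegree = 1 := by
  refine le_antisymm ?_ ?_
  · refine (totalDegree_sub_C_le _ _).trans (by simp)
  refine le_trans (le_of_eq ?_) (natDegree_aeval_le_totalDegree _ ![0, 0, Polynomial.X] ?_)
  · have : aeval ![0, 0, Polynomial.X] (X 2 - C k : Poly) =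
        (Polynomial.X - Polynomial.C k : Polynomial ℝ) := by
      simp
    rw [this]
    symm
    compute_degree!
  · intro i
    fin_cases i <;> simp

theorem totalDegree_le_of_eq_X2_sub_C_mul (k : ℝ) (F G : Poly) (n : ℕ) (h : F = (X 2 - C k) * G)
    (hF : F.totalDegree ≤ n + 1) : G.totalDegree ≤ n := by
  rcases eq_or_ne G 0 with rfl | hG
  · simp
  have hne : (X 2 - C k : Poly) ≠ 0 := by
    intro h0
    have := totalDegree_planePoly k
    simp [h0] at this
  rw [h, totalDegree_mul_of_isDomain hne hG, totalDegree_planePoly] at hF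
  omega

theorem totalDegree_le_of_le_degree {χ : VField} (i : Fin 3) : (χ i).totalDegree ≤ degree χ := by
  fin_cases i <;> simp [degree]

/-! ### The explicit form of the field -/

/-- The third component vanishes on the planes `z = ±1`. On `z = ε` with `ε² = 1` the torus equation
becomes `u² = 0` with `u = x² + y² - a²`, so invariance of the torus makes the quadric `u` divide the
restriction of `R`; but that restriction is a polynomial of degree at most one in `x, y`. -/
theorem restrictPlane_eq_zero_of_isInvariant {a : ℝ} {χ : VField}
    (htorus : IsInvariant χ (torusPoly a)) {k₁ k₂ : ℝ} {L : Poly} (hL : L.totalDegree ≤ 1)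
    (hR : χ 2 = (X 2 - C k₁) * ((X 2 - C k₂) * L)) {ε : ℝ} (hε : ε ^ 2 = 1) :
    restrictPlane ε (χ 2) = 0 := by
  obtain ⟨K, hK⟩ := htorus
  have hε0 : ε ≠ 0 := by rintro rfl; norm_num at hε
  obtain ⟨l, p, q, r, rfl⟩ := eq_linear_of_totalDegree_le_one L hL
  have hS : restrictPlane ε (χ 2) = C ((ε - k₁) * (ε - k₂)) *
      (C (l + r * ε) + C p * X 0 + C q * X 1) := by
    rw [hR]
    simp only [map_mul, map_sub, map_add, restrictPlane_X0, restrictPlane_X1, restrictPlane_X2,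
      restrictPlane_C]
    ring
  have hdvd : (X 0 ^ 2 + X 1 ^ 2 - C (a ^ 2) : Poly) ∣ restrictPlane ε (χ 2) := by
    have hKε := congrArg (restrictPlane ε) hK
    rw [act_torusPoly, torusPoly] at hKε
    simp only [map_mul, map_sub, map_add, map_pow, map_one, map_ofNat, restrictPlane_X0,
      restrictPlane_X1, restrictPlane_X2, restrictPlane_C] at hKε
    rw [← map_pow C ε, hε] at hKε
    have hu : IsUnit (2 * C ε : Poly) := by
      rw [show (2 * C ε : Poly) = C (2 * ε) by rw [C_mul, map_ofNat]]
      exact (IsUnit.mk0 _ (mul_ne_zero two_ne_zero hε0)).map C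
    refine (hu.dvd_mul_left).1 ⟨restrictPlane ε K * (X 0 ^ 2 + X 1 ^ 2 - C (a ^ 2)) -
      4 * (X 0 * restrictPlane ε (χ 0) + X 1 * restrictPlane ε (χ 1)), ?_⟩
    simp only [map_one, map_pow] at hKε ⊢
    linear_combination hKε
  by_contra hne
  have h1 := totalDegree_le_of_dvd_of_isDomain hdvd hne
  have h2 := le_totalDegree_cylinder (a ^ 2)
  have h3 : (restrictPlane ε (χ 2)).totalDegree ≤ 1 := by
    rw [hS]
    refine (totalDegree_mul _ _).trans ?_
    rw [totalDegree_C, zero_add]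
    refine (totalDegree_add _ _).trans (max_le ((totalDegree_add _ _).trans (max_le ?_ ?_)) ?_)
    · simp only [totalDegree_C, zero_le_one]
    · exact (totalDegree_mul _ _).trans (by simp)
    · exact (totalDegree_mul _ _).trans (by simp)
  omega

/-- Two invariant parallel planes, counted with multiplicity, split off two linear factors of the
third component, in the confluent case through the extactic polynomial. -/
theorem exists_eq_mul_of_hasTwo {χ : VField} (hdeg : degree χ ≤ 3)
    (htwo : HasTwoInvariantParallelPlanes χ) : ∃ (k₁ k₂ : ℝ) (L : Poly), L.totalDegree ≤ 1 ∧
      χ 2 = (X 2 - C k₁) * ((X 2 - C k₂) * L) := by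
  obtain ⟨k₁, k₂, h1, h2, h12⟩ := htwo
  have hd : (χ 2).totalDegree ≤ 3 := (totalDegree_le_of_le_degree 2).trans hdeg
  obtain ⟨L, hL⟩ : ∃ L, χ 2 = (X 2 - C k₁) * ((X 2 - C k₂) * L) := by
    rw [isInvariantParallelPlane_iff] at h1 h2
    by_cases hk : k₁ = k₂
    · have := pow_dvd_of_le_emultiplicity (k := 2) (h12 hk)
      rw [extactic_one_X, planePoly] at this
      obtain ⟨L, hL⟩ := this
      exact ⟨L, by rw [hL, ← hk]; ring⟩
    · obtain ⟨G, hG⟩ := h1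
      rw [X2_sub_C_dvd_iff, hG, map_mul] at h2
      have : restrictPlane k₂ G = 0 := by
        refine (mul_eq_zero.1 h2).resolve_left fun h0 => hk ?_
        rw [map_sub, restrictPlane_X2, restrictPlane_C, ← C_sub, C_eq_zero] at h0
        linarith
      obtain ⟨L, rfl⟩ := (X2_sub_C_dvd_iff _ _).2 this
      exact ⟨L, hG⟩
  refine ⟨k₁, k₂, L, ?_, hL⟩
  exact totalDegree_le_of_eq_X2_sub_C_mul k₂ _ L 1 rfl
    (totalDegree_le_of_eq_X2_sub_C_mul k₁ _ _ 2 hL hd)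

theorem sq_sub_one_dvd {a : ℝ} {χ : VField} (hdeg : degree χ ≤ 3)
    (htorus : IsInvariant χ (torusPoly a)) (htwo : HasTwoInvariantParallelPlanes χ) :
    (X 2 ^ 2 - 1 : Poly) ∣ χ 2 := by
  obtain ⟨k₁, k₂, L, hL, hR⟩ := exists_eq_mul_of_hasTwo hdeg htwo
  exact (sq_sub_one_dvd_iff _).2 ⟨restrictPlane_eq_zero_of_isInvariant htorus hL hR (by norm_num),
    restrictPlane_eq_zero_of_isInvariant htorus hL hR (by norm_num)⟩

/-- The third component and the horizontal radial component `xP + yQ` of the field. With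
`u = x² + y² - a²`, `T = u² + z² - 1` and `R = (z² - 1) L`, invariance of the torus yields
`4 (xP + yQ) = 2 z L u + V T`, where `V` is a constant by degrees; on the axis `x = y = 0` this forces
first `V = 0`, which uses `a⁴ ≠ 1`, and then that `L` has no terms in `1` and `z`. -/
theorem exists_polar_eq {a : ℝ} (ha : 1 < a) {χ : VField} (hdeg : degree χ ≤ 3)
    (htorus : IsInvariant χ (torusPoly a)) (hdvd : (X 2 ^ 2 - 1 : Poly) ∣ χ 2) :
    ∃ p q : ℝ, χ 2 = (C p * X 0 + C q * X 1) * (X 2 ^ 2 - 1) ∧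
      2 * (X 0 * χ 0 + X 1 * χ 1) =
        X 2 * (C p * X 0 + C q * X 1) * (X 0 ^ 2 + X 1 ^ 2 - C (a ^ 2)) := by
  obtain ⟨L, hR⟩ := hdvd
  have hL : L.totalDegree ≤ 1 :=
    totalDegree_le_of_eq_X2_sub_C_mul (-1) _ L 1 rfl (totalDegree_le_of_eq_X2_sub_C_mul 1 _ _ 2
      (by rw [hR]; simp only [map_neg, map_one]; ring)
      ((totalDegree_le_of_le_degree (χ := χ) 2).trans hdeg))
  obtain ⟨K, hK⟩ := htorus
  rw [act_torusPoly, hR, torusPoly] at hK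
  set u : Poly := X 0 ^ 2 + X 1 ^ 2 - C (a ^ 2) with hu
  have hu0 : u ≠ 0 := fun h0 => by
    have := le_totalDegree_cylinder (a ^ 2)
    rw [← hu, h0] at this
    simp at this
  have hures (k : ℝ) : restrictPlane k u = u := by simp [hu]
  -- Both `z - 1` and `z + 1` are coprime to `u`, so `z² - 1` can be cancelled against it.
  obtain ⟨V, hV⟩ : (X 2 ^ 2 - 1 : Poly) ∣ 4 * (X 0 * χ 0 + X 1 * χ 1) - K * u := by
    have key : u * (4 * (X 0 * χ 0 + X 1 * χ 1) - K * u) =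
        (X 2 ^ 2 - 1) * (K - 2 * X 2 * L) := by linear_combination hK
    have hk := (sq_sub_one_dvd_iff _).1 ⟨_, key⟩
    rw [map_mul, map_mul, hures, hures] at hk
    exact (sq_sub_one_dvd_iff _).2
      ⟨(mul_eq_zero.1 hk.1).resolve_left hu0, (mul_eq_zero.1 hk.2).resolve_left hu0⟩
  have hz : (X 2 ^ 2 - 1 : Poly) ≠ 0 := fun h0 => by
    have := congrArg (eval (0 : Fin 3 → ℝ)) h0
    simp at this
  have hKV : K = 2 * X 2 * L + u * V := by
    refine mul_left_cancel₀ hz ?_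
    linear_combination u * hV - hK
  have hmain : 4 * (X 0 * χ 0 + X 1 * χ 1) = 2 * X 2 * L * u + V * torusPoly a := by
    rw [torusPoly, ← hu]
    linear_combination hV + u * hKV
  have hu2 : u.totalDegree ≤ 2 := by
    refine (totalDegree_sub_C_le _ _).trans ((totalDegree_add _ _).trans (max_le ?_ ?_)) <;> simp
  have h4 : (4 : Poly) = C 4 := (map_ofNat C 4).symm
  have h2 : (2 : Poly) = C 2 := (map_ofNat C 2).symm
  obtain ⟨c, rfl⟩ : ∃ c : ℝ, V = C c := by
    rcases eq_or_ne V 0 with rfl | hV0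
    · exact ⟨0, by simp⟩
    have hT4 := le_totalDegree_torusPoly a
    have hT0 : torusPoly a ≠ 0 := fun h0 => by simp [h0] at hT4
    have hVT : (V * torusPoly a).totalDegree ≤ 4 := by
      rw [show V * torusPoly a = C 4 * (X 0 * χ 0 + X 1 * χ 1) - C 2 * (X 2 * L * u) by
        rw [← h4, ← h2, hmain]; ring]
      have hP := (totalDegree_le_of_le_degree (χ := χ) 0).trans hdeg
      have hQ := (totalDegree_le_of_le_degree (χ := χ) 1).trans hdeg
      refine (totalDegree_sub _ _).trans (max_le ?_ ?_)
      · refine (totalDegree_mul _ _).trans ?_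
        rw [totalDegree_C, zero_add]
        refine (totalDegree_add _ _).trans (max_le ?_ ?_)
        · refine (totalDegree_mul _ _).trans ?_
          rw [totalDegree_X]; omega
        · refine (totalDegree_mul _ _).trans ?_
          rw [totalDegree_X]; omega
      · refine (totalDegree_mul _ _).trans ?_
        have h1 := totalDegree_mul (X 2 * L) u
        have h2 := totalDegree_mul (X 2) L
        rw [totalDegree_X] at h2
        rw [totalDegree_C]; omega
    rw [totalDegree_mul_of_isDomain hV0 hT0] at hVT
    exact ⟨_, totalDegree_eq_zero_iff_eq_C.1 (by omega)⟩
  obtain ⟨l, p, q, r, rfl⟩ := eq_linear_of_totalDegree_le_one L hL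
  -- Evaluation of `hmain` at the point `(0, 0, t)` of the axis.
  have haxis (t : ℝ) : 2 * t * (l + r * t) * (-a ^ 2) + c * (a ^ 4 + t ^ 2 - 1) = 0 := by
    have := congrArg (eval ![0, 0, t]) hmain
    simp [torusPoly, hu] at this
    linear_combination -this
  have ha4 : 0 < a ^ 4 - 1 := by
    have : 1 < a ^ 4 := one_lt_pow₀ ha (by norm_num)
    linarith
  have hc : c = 0 := by
    have := haxis 0
    have h : c * (a ^ 4 - 1) = 0 := by linear_combination this
    exact (mul_eq_zero.1 h).resolve_right ha4.ne'
  subst hc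
  have ha2 : a ^ 2 ≠ 0 := by positivity
  have h1 : l + r = 0 := by
    have : a ^ 2 * (l + r) = 0 := by linear_combination -(1 / 2) * haxis 1
    exact (mul_eq_zero.1 this).resolve_left ha2
  have h2 : l - r = 0 := by
    have : a ^ 2 * (l - r) = 0 := by linear_combination (1 / 2) * haxis (-1)
    exact (mul_eq_zero.1 this).resolve_left ha2
  obtain rfl : l = 0 := by linarith
  obtain rfl : r = 0 := by linarith
  refine ⟨p, q, ?_, ?_⟩
  · rw [hR]; simp only [map_zero]; ring
  · refine mul_left_cancel₀ (two_ne_zero : (2 : Poly) ≠ 0) ?_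
    simp only [map_zero] at hmain
    linear_combination hmain

theorem exists_eq_mul_of_mul_X_add_mul_X_eq_zero {A B : Poly} {n : ℕ}
    (hA : A.totalDegree ≤ n + 1) (h : X 0 * A + X 1 * B = 0) :
    ∃ f : Poly, f.totalDegree ≤ n ∧ A = f * X 1 ∧ B = -(f * X 0) := by
  have hdvd : (X 1 : Poly) ∣ X 0 * A := ⟨-B, by linear_combination h⟩
  rcases X_dvd_mul_iff.1 hdvd with h0 | h0
  · rw [X_dvd_X] at h0
    norm_num at h0
  obtain ⟨f, rfl⟩ := h0
  refine ⟨f, ?_, mul_comm _ _, ?_⟩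
  · rcases eq_or_ne f 0 with rfl | hf
    · simp
    rw [totalDegree_mul_of_isDomain (X_ne_zero 1) hf, totalDegree_X] at hA
    omega
  · refine mul_left_cancel₀ (X_ne_zero (1 : Fin 3) : (X 1 : Poly) ≠ 0) ?_
    linear_combination h

theorem exists_hasForm {a : ℝ} (ha : 1 < a) {χ : VField} (hdeg : degree χ ≤ 3)
    (htorus : IsInvariant χ (torusPoly a)) (hdvd : (X 2 ^ 2 - 1 : Poly) ∣ χ 2) :
    ∃ (f : Poly) (p q : ℝ), HasForm a χ f p q := by
  obtain ⟨p, q, hR, hPQ⟩ := exists_polar_eq ha hdeg htorus hdvd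
  have htwo : (2 : Poly) * C (1 / 2) = 1 := by
    rw [show (2 : Poly) = C 2 from (map_ofNat C 2).symm, ← C_mul]; norm_num
  have hhalf (s : ℝ) : (C (a ^ 2 * s / 2) : Poly) = C (1 / 2) * C (a ^ 2) * C s := by
    rw [← C_mul, ← C_mul]; congr 1; ring
  have hdegA : (χ 0 - (C (1 / 2) * X 0 * X 2 * (C p * X 0 + C q * X 1) -
      C (a ^ 2 * p / 2) * X 2)).totalDegree ≤ 2 + 1 := by
    have hlin : (C p * X 0 + C q * X 1 : Poly).totalDegree ≤ 1 :=
      (totalDegree_add _ _).trans (max_le ((totalDegree_mul _ _).trans (by simp))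
        ((totalDegree_mul _ _).trans (by simp)))
    refine (totalDegree_sub _ _).trans (max_le ((totalDegree_le_of_le_degree 0).trans hdeg) ?_)
    refine (totalDegree_sub _ _).trans (max_le ?_ ((totalDegree_mul _ _).trans (by simp)))
    have h1 := totalDegree_mul (C (1 / 2) * X 0 * X 2 : Poly) (C p * X 0 + C q * X 1)
    have h2 := totalDegree_mul (C (1 / 2) * X 0 : Poly) (X 2)
    have h3 := totalDegree_mul (C (1 / 2) : Poly) (X 0)
    rw [totalDegree_X] at h2 h3
    rw [totalDegree_C] at h3
    omega
  obtain ⟨f, hf, h0, h1⟩ := exists_eq_mul_of_mul_X_add_mul_X_eq_zero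
    (B := χ 1 - (C (1 / 2) * X 1 * X 2 * (C p * X 0 + C q * X 1) - C (a ^ 2 * q / 2) * X 2))
    hdegA (by
      rw [hhalf, hhalf]
      linear_combination C (1 / 2) * hPQ - (X 0 * χ 0 + X 1 * χ 1) * htwo)
  exact ⟨f, p, q, hf, by linear_combination h0, by linear_combination h1, hR⟩

/-- Finiteness rules out `R = 0`, for which every parallel plane is invariant. -/
theorem setOf_isInvariantParallelPlane_eq {a : ℝ} {χ : VField} {f : Poly} {p q : ℝ}
    (h : HasForm a χ f p q) (hfin : {k : ℝ | IsInvariantParallelPlane χ k}.Finite) :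
    {k : ℝ | IsInvariantParallelPlane χ k} = {1, -1} := by
  obtain ⟨-, -, -, hR⟩ := h
  have hne : (C p * X 0 + C q * X 1 : Poly) ≠ 0 := fun h0 => by
    rw [h0, zero_mul] at hR
    refine Set.infinite_univ (α := ℝ) (hfin.subset fun k _ => ?_)
    rw [Set.mem_ofPred_eq, isInvariantParallelPlane_iff, hR]
    exact dvd_zero _
  ext k
  rw [Set.mem_ofPred_eq, isInvariantParallelPlane_iff, X2_sub_C_dvd_iff, hR]
  have : restrictPlane k ((C p * X 0 + C q * X 1) * (X 2 ^ 2 - 1)) =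
      (C p * X 0 + C q * X 1) * C (k ^ 2 - 1) := by simp
  rw [this, mul_eq_zero, or_iff_right hne, C_eq_zero, sub_eq_zero, sq_eq_one_iff]
  rfl

/-! ### Rotation along a circle -/

/-- The equation `θ' = h(θ)` with positive `2π`-periodic `h` has a global solution that covers the
whole line and winds once around in finite time: it is the inverse of `x ↦ ∫₀ˣ 1/h`. -/
theorem exists_angle_of_pos {h : ℝ → ℝ} (hc : Continuous h)
    (hper : Function.Periodic h (2 * Real.pi)) (hpos : ∀ x, 0 < h x) :
    ∃ (θ : ℝ → ℝ) (T : ℝ), 0 < T ∧ (∀ t, HasDerivAt θ (h (θ t)) t) ∧ Function.Surjective θ ∧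
      ∀ t, θ (t + T) = θ t + 2 * Real.pi := by
  have hgc : Continuous fun x => (h x)⁻¹ := hc.inv₀ fun x => (hpos x).ne'
  have hgper : Function.Periodic (fun x => (h x)⁻¹) (2 * Real.pi) := fun x => by simp only [hper x]
  have hgpos (x : ℝ) : 0 < (h x)⁻¹ := inv_pos.2 (hpos x)
  have hint (x y : ℝ) : IntervalIntegrable (fun x => (h x)⁻¹) MeasureTheory.volume x y :=
    hgc.intervalIntegrable x y
  set τ : ℝ → ℝ := fun x => ∫ s in (0 : ℝ)..x, (h s)⁻¹ with hτ
  have hderiv (x : ℝ) : HasDerivAt τ (h x)⁻¹ x :=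
    intervalIntegral.integral_hasDerivAt_right (hint 0 x)
      (hgc.stronglyMeasurableAtFilter _ _) hgc.continuousAt
  have hmono : StrictMono τ :=
    strictMono_of_deriv_pos fun x => by rw [(hderiv x).deriv]; exact hgpos x
  have hτc : Continuous τ := continuous_iff_continuousAt.2 fun x => (hderiv x).continuousAt
  have hsurj : Function.Surjective τ := hτc.surjective
    (hgper.tendsto_atTop_intervalIntegral_of_pos' (hint _ _) hgpos Real.two_pi_pos)
    (hgper.tendsto_atBot_intervalIntegral_of_pos' (hint _ _) hgpos Real.two_pi_pos)
  let e : ℝ ≃o ℝ := hmono.orderIsoOfSurjective τ hsurj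
  have he (x : ℝ) : e x = τ x := rfl
  have hadd (x : ℝ) : τ (x + 2 * Real.pi) = τ x + τ (2 * Real.pi) := by
    simp only [hτ]
    rw [← intervalIntegral.integral_add_adjacent_intervals (hint 0 x) (hint x _),
      hgper.intervalIntegral_add_eq x 0, zero_add]
  refine ⟨e.symm, τ (2 * Real.pi), ?_, fun t => ?_, e.symm.surjective, fun t => ?_⟩
  · have := hmono Real.two_pi_pos
    simpa [hτ] using this
  · have := HasDerivAt.of_local_left_inverse (f := τ) (g := e.symm) (a := t)
      e.symm.continuous.continuousAt (hderiv _) (hgpos _).ne'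
      (Filter.Eventually.of_forall fun y => by rw [← he, e.apply_symm_apply])
    rwa [inv_inv] at this
  · rw [e.symm_apply_eq, he, hadd, ← he (e.symm t), e.apply_symm_apply]

/-- By the intermediate value theorem `h` has a constant sign; the negative case is the mirror image
of the positive one. -/
theorem exists_angle_of_ne_zero {h : ℝ → ℝ} (hc : Continuous h)
    (hper : Function.Periodic h (2 * Real.pi)) (hne : ∀ x, h x ≠ 0) :
    ∃ (θ : ℝ → ℝ) (T : ℝ), 0 < T ∧ (∀ t, HasDerivAt θ (h (θ t)) t) ∧ Function.Surjective θ ∧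
      ((∀ t, θ (t + T) = θ t + 2 * Real.pi) ∨ ∀ t, θ (t + T) = θ t - 2 * Real.pi) := by
  have hsign : (∀ x, 0 < h x) ∨ ∀ x, h x < 0 := by
    by_contra! H
    obtain ⟨⟨x, hx⟩, y, hy⟩ := H
    obtain ⟨z, hz⟩ := mem_range_of_exists_le_of_exists_ge hc ⟨x, hx⟩ ⟨y, hy⟩
    exact hne z hz
  rcases hsign with hpos | hneg
  · obtain ⟨θ, T, hT, hd, hs, hp⟩ := exists_angle_of_pos hc hper hpos
    exact ⟨θ, T, hT, hd, hs, Or.inl hp⟩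
  · obtain ⟨θ, T, hT, hd, hs, hp⟩ := exists_angle_of_pos (h := fun x => -h (-x))
      (hc.comp continuous_neg).neg
      (fun x => by
        have := hper (-x - 2 * Real.pi)
        rw [sub_add_cancel] at this
        simp only [neg_add', this])
      (fun x => neg_pos.2 (hneg _))
    refine ⟨fun t => -θ t, T, hT, fun t => ?_, fun x => ?_, Or.inr fun t => ?_⟩
    · have := (hd t).neg
      rw [neg_neg] at this
      exact this
    · obtain ⟨t, ht⟩ := hs (-x)
      exact ⟨t, by simp [ht]⟩
    · simp only [hp]; ring

/-! ### Parallels as periodic orbits -/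

theorem contDiff_eval (χ : VField) :
    ContDiff ℝ 1 (fun v : Fin 3 → ℝ => fun i => eval v (χ i)) := by
  refine contDiff_pi.2 fun i => ?_
  exact contDiffOn_univ.1 ((AnalyticOnNhd.eval_mvPolynomial (χ i)).contDiffOn uniqueDiffOn_univ)

/-- A periodic solution through a zero of the field is constant, by uniqueness for the initial value
problem: the field is Lipschitz on the trace, which is compact by periodicity. -/
theorem IsSolution.eq_of_eval_eq_zero {χ : VField} {γ : ℝ → Fin 3 → ℝ} (hγ : IsSolution χ γ)
    {T : ℝ} (hT : 0 < T) (hper : Function.Periodic γ T) {t₀ : ℝ}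
    (h0 : ∀ i, eval (γ t₀) (χ i) = 0) (t : ℝ) : γ t = γ t₀ := by
  have hcont : Continuous γ := continuous_iff_continuousAt.2 fun s => (hγ s).continuousAt
  obtain ⟨K, hK⟩ := LocallyLipschitzOn.exists_lipschitzOnWith_of_compact
    (hper.compact_of_continuous hT.ne' hcont)
    (contDiff_eval χ).locallyLipschitz.locallyLipschitzOn
  have := ODE_solution_unique_univ (v := fun _ v i => eval v (χ i)) (s := fun _ => Set.range γ)
    (f := γ) (g := fun _ => γ t₀) (t₀ := t₀) (fun _ => hK) (fun s => ⟨hγ s, s, rfl⟩)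
    (fun s => ⟨by simp only [h0]; exact hasDerivAt_const s (γ t₀), t₀, rfl⟩) rfl
  exact congrFun this t

theorem mem_parallel_iff {a k : ℝ} (hk : k ^ 2 = 1) (v : Fin 3 → ℝ) :
    v ∈ parallel a k ↔ v 0 ^ 2 + v 1 ^ 2 = a ^ 2 ∧ v 2 = k := by
  simp only [parallel, torus, torusPoly, Set.mem_inter_iff, Set.mem_ofPred_eq, map_sub, map_add,
    map_pow, map_one, eval_X, eval_C]
  refine and_congr_left fun h => ?_
  rw [h, hk, add_sub_cancel_right, sq_eq_zero_iff, sub_eq_zero]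

/-- If the field on the parallel is the clockwise rotation field `(y, -x, 0)` times a polynomial `G`,
then the parallel is a periodic orbit exactly when `G` has no zero on it. -/
theorem isPeriodicOrbit_parallel_iff {a k : ℝ} (ha : 0 < a) (hk : k ^ 2 = 1) {χ : VField}
    {G : Poly}
    (hP : ∀ v ∈ parallel a k, eval v (χ 0) = v 1 * eval v G)
    (hQ : ∀ v ∈ parallel a k, eval v (χ 1) = -(v 0 * eval v G))
    (hR : ∀ v ∈ parallel a k, eval v (χ 2) = 0) :
    IsPeriodicOrbit χ (parallel a k) ↔ ∀ v ∈ parallel a k, eval v G ≠ 0 := by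
  constructor
  · rintro ⟨γ, hγ, ⟨T, hT, hper⟩, ⟨s, t, hst⟩, hrange⟩ v hv hG
    obtain ⟨t₀, rfl⟩ := hrange.symm ▸ hv
    have h0 (i : Fin 3) : eval (γ t₀) (χ i) = 0 := by
      fin_cases i
      · simp [hP _ hv, hG]
      · simp [hQ _ hv, hG]
      · exact hR _ hv
    exact hst ((hγ.eq_of_eval_eq_zero hT hper h0 s).trans
      (hγ.eq_of_eval_eq_zero hT hper h0 t).symm)
  · intro hG
    -- Along this clockwise parametrization the system reduces to `θ' = G (c θ)`.
    let c : ℝ → Fin 3 → ℝ := fun φ => ![a * Real.sin φ, a * Real.cos φ, k]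
    have hc : Continuous c := by
      refine continuous_pi fun i => ?_
      fin_cases i <;> simp [c] <;> fun_prop
    have hcmem (φ : ℝ) : c φ ∈ parallel a k := by
      rw [mem_parallel_iff hk]
      refine ⟨?_, by simp [c]⟩
      simp only [c, Matrix.cons_val_zero, Matrix.cons_val_one]
      linear_combination a ^ 2 * Real.sin_sq_add_cos_sq φ
    have hcper : Function.Periodic c (2 * Real.pi) := fun φ => by simp [c]
    obtain ⟨θ, T, hT, hd, hs, hp⟩ := exists_angle_of_ne_zero (h := fun φ => eval (c φ) G)
      ((MvPolynomial.continuous_eval G).comp hc) (fun φ => by simp only [hcper φ])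
      (fun φ => hG _ (hcmem φ))
    refine ⟨fun t => c (θ t), fun t => ?_, ⟨T, hT, fun t => ?_⟩, ?_, ?_⟩
    · rw [hasDerivAt_pi]
      intro i
      fin_cases i
      · have := ((hd t).sin).const_mul a
        simpa [hP _ (hcmem _), c, mul_assoc] using this
      · have := ((hd t).cos).const_mul a
        simpa [hQ _ (hcmem _), c, mul_assoc] using this
      · simpa [hR _ (hcmem _), c] using hasDerivAt_const t k
    · rcases hp with hp | hp
      · simp only [hp, hcper (θ t)]
      · simp only [hp, hcper.sub_eq (θ t)]
    · obtain ⟨s, h1⟩ := hs 0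
      obtain ⟨t, h2⟩ := hs (Real.pi / 2)
      refine ⟨s, t, fun h => ha.ne' ?_⟩
      have := congrFun h 1
      simpa [h1, h2, c] using this
    · ext v
      constructor
      · rintro ⟨t, rfl⟩
        exact hcmem _
      · intro hv
        obtain ⟨hv1, hv2⟩ := (mem_parallel_iff hk v).1 hv
        obtain ⟨φ, h1, h2⟩ : ∃ φ, v 1 = a * Real.cos φ ∧ v 0 = a * Real.sin φ := by
          have hn : ‖(⟨v 1, v 0⟩ : ℂ)‖ = a := by
            rw [← sq_eq_sq₀ (norm_nonneg _) ha.le, Complex.sq_norm, Complex.normSq_mk]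
            linear_combination hv1
          refine ⟨Complex.arg ⟨v 1, v 0⟩, ?_, ?_⟩
          · simpa [hn] using (Complex.norm_mul_cos_arg ⟨v 1, v 0⟩).symm
          · simpa [hn] using (Complex.norm_mul_sin_arg ⟨v 1, v 0⟩).symm
        obtain ⟨t, rfl⟩ := hs φ
        refine ⟨t, ?_⟩
        ext i
        fin_cases i <;> simp [c, h1, h2, hv2]

theorem isPeriodicOrbit_parallel_iff_of_hasForm {a ε : ℝ} (ha : 0 < a) (hε : ε ^ 2 = 1)
    {χ : VField} {f : Poly} {p q : ℝ} (h : HasForm a χ f p q) :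
    IsPeriodicOrbit χ (parallel a ε) ↔ ¬ ∃ x y : ℝ, x ^ 2 + y ^ 2 = a ^ 2 ∧
      eval ![x, y, ε] f - ε / 2 * (p * y - q * x) = 0 := by
  obtain ⟨-, hP, hQ, hR⟩ := h
  rw [isPeriodicOrbit_parallel_iff ha hε (G := f - C (ε / 2) * (C p * X 1 - C q * X 0))]
  · constructor
    · rintro hG ⟨x, y, hxy, h0⟩
      refine hG ![x, y, ε] ((mem_parallel_iff hε _).2 ⟨by simpa using hxy, by simp⟩) ?_
      simpa using h0
    · intro hG v hv h0
      obtain ⟨hv1, hv2⟩ := (mem_parallel_iff hε v).1 hv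
      refine hG ⟨v 0, v 1, hv1, ?_⟩
      have hvec : ![v 0, v 1, ε] = v := by
        ext i
        fin_cases i <;> simp [hv2]
      rw [hvec]
      simpa using h0
  all_goals
    intro v hv
    obtain ⟨hv1, hv2⟩ := (mem_parallel_iff hε v).1 hv
  · simp only [hP, map_add, map_sub, map_mul, eval_C, eval_X, hv2]
    linear_combination (ε * p / 2) * hv1
  · simp only [hQ, map_add, map_sub, map_mul, eval_C, eval_X, hv2]
    linear_combination (ε * q / 2) * hv1
  · simp [hR, hv2, hε]

end TorusField

theorem theorem2p6 (a : ℝ) (ha : 1 < a) (χ : TorusField.VField)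
    (hdeg : TorusField.degree χ ≤ 3)
    (htorus : TorusField.IsInvariant χ (TorusField.torusPoly a))
    (htwo : TorusField.HasTwoInvariantParallelPlanes χ) :
    (∃ (f : TorusField.Poly) (p q : ℝ), TorusField.HasForm a χ f p q) ∧
    (TorusField.IsInvariantParallelPlane χ 1 ∧ TorusField.IsInvariantParallelPlane χ (-1)) ∧
    ({k : ℝ | TorusField.IsInvariantParallelPlane χ k}.Finite →
      {k : ℝ | TorusField.IsInvariantParallelPlane χ k} = {1, -1}) ∧
    (∀ (f : TorusField.Poly) (p q : ℝ), TorusField.HasForm a χ f p q →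
      (TorusField.IsPeriodicOrbit χ (TorusField.parallel a 1) ↔
        ¬ ∃ x y : ℝ, x ^ 2 + y ^ 2 = a ^ 2 ∧
          MvPolynomial.eval ![x, y, 1] f - 1 / 2 * (p * y - q * x) = 0) ∧
      (TorusField.IsPeriodicOrbit χ (TorusField.parallel a (-1)) ↔
        ¬ ∃ x y : ℝ, x ^ 2 + y ^ 2 = a ^ 2 ∧
          MvPolynomial.eval ![x, y, -1] f + 1 / 2 * (p * y - q * x) = 0)) := by
  have hdvd := TorusField.sq_sub_one_dvd hdeg htorus htwo
  obtain ⟨f, p, q, hform⟩ := TorusField.exists_hasForm ha hdeg htorus hdvd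
  have ha0 : 0 < a := by linarith
  obtain ⟨h1, h2⟩ := (TorusField.sq_sub_one_dvd_iff _).1 hdvd
  refine ⟨⟨f, p, q, hform⟩, ⟨?_, ?_⟩, TorusField.setOf_isInvariantParallelPlane_eq hform,
    fun f p q h => ⟨?_, ?_⟩⟩
  · rwa [TorusField.isInvariantParallelPlane_iff, TorusField.X2_sub_C_dvd_iff]
  · rwa [TorusField.isInvariantParallelPlane_iff, TorusField.X2_sub_C_dvd_iff]
  · exact TorusField.isPeriodicOrbit_parallel_iff_of_hasForm ha0 (by norm_num) h
  · rw [TorusField.isPeriodicOrbit_parallel_iff_of_hasForm ha0 (by norm_num) h]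
    simp only [neg_div, neg_mul, sub_neg_eq_add]
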